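/- Let $K$ be a field, let $1\le m_1<m_2<\dots<m_k<n$ be integers and put $M=\{m_1,\dots,m_k\}$. Let $X=(x_{ij})$ be an $m_k\times n$ matrix of indeterminates. For $p\le m_k$ and $1\le a_1<\dots<a_p\le n$ let $[a_1,\dots,a_p]$ be the $p$-minor of $X$ with row indices $1,\dots,p$ and column indices $a_1,\dots,a_p$. Let $$L(M,n)=\{[a_1,\dots,a_p] : 1\le a_1<\dots<a_p\le n,\ p\in M\},$$ partially ordered by $[a_1,\dots,a_p]\le[b_1,\dots,b_q]$ if $p\ge q$ and $a_i\le b_i$ for $i=1,\dots,q$; this is a distributive lattice. Let $\operatorname{Flag}(M,n)\subseteq K[x_{ij}]$ be the $K$-subalgebra generated by the minors in $L(M,n)$, and let $B(M,n)$ be the set of standard monomials, i.e. of products $\delta_1\cdots\delta_v$ with $v\ge 0$, $\delta_i\in L(M,n)$ and $\delta_1\le\delta_2\le\dots\le\delta_v$. Let $\succ$ be a diagonal term order on $K[x_{ij}]$, i.e. a term order for which the initial term of every minor of $X$ is the product of the entries on its main diagonal. For a $K$-subalgebra $R$ of $K[x_{ij}]$ let the initial algebra $\operatorname{in}_\succ(R)$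 be the $K$-span of $\{\operatorname{in}_\succ(f): f\in R\}$. Then: 1. The minors in $L(M,n)$ form a Sagbi basis of $\operatorname{Flag}(M,n)$, that is, $\operatorname{in}_\succ(\operatorname{Flag}(M,n))=K[\operatorname{in}_\succ(\delta):\delta\in L(M,n)]$. 2. The initial terms $\operatorname{in}_\succ(\delta_1\cdots\delta_v)$ of the standard monomials, indexed by the sequences $\delta_1\le\dots\le\delta_v$ in $L(M,n)$, form a $K$-basis of $\operatorname{in}_\succ(\operatorname{Flag}(M,n))$ (in particular, they are pairwise distinct). 3. $\operatorname{in}_\succ(\operatorname{Flag}(M,n))$ is the Hibi ring of $L(M,n)$: there is a $K$-algebra isomorphism from $$H(L(M,n))=K[t_\delta:\delta\in L(M,n)]\,/\,\bigl(t_\delta t_\gamma-t_{\delta\wedge\gamma}t_{\delta\vee\gamma} : \delta,\gamma \text{ incomparable in } L(M,n)\bigr)$$ onto $\operatorname{in}_\succ(\operatorname{Flag}(M,n))$ that sends the class of $t_\delta$ to $\operatorname{in}_\succ(\delta)$ for every $\delta\in L(M,n)$. -/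

import Mathlib

open MvPolynomial

/-! ### Initial algebras and Sagbi bases -/

/-- The initial algebra of a subalgebra `R` of a polynomial ring with respect to a term order:
the `K`-vector space generated by the initial terms of the elements of `R`
(which is closed under multiplication). -/
noncomputable def MonomialOrder.initialAlgebra {σ K : Type*} [Field K] (m : MonomialOrder σ)
    (R : Subalgebra K (MvPolynomial σ K)) : Subalgebra K (MvPolynomial σ K) :=
  (Submodule.span K (m.leadingTerm '' (R : Set (MvPolynomial σ K)))).toSubalgebra
    (Submodule.subset_span ⟨1, R.one_mem, by simp [MonomialOrder.leadingTerm]⟩)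
    (by
      intro x y hx hy
      have hxy := Submodule.mul_mem_mul hx hy
      rw [Submodule.span_mul_span] at hxy
      refine Submodule.span_mono ?_ hxy
      rintro _ ⟨_, ⟨f, hf, rfl⟩, _, ⟨g, hg, rfl⟩, rfl⟩
      refine ⟨f * g, R.mul_mem hf hg, ?_⟩
      by_cases hf0 : f = 0
      · simp [hf0]
      by_cases hg0 : g = 0
      · simp [hg0]
      simp [MonomialOrder.leadingTerm, m.degree_mul hf0 hg0, MvPolynomial.monomial_mul])

/-- A subset `S` of `R` is a Sagbi basis of `R` with respect to the term order `m` if the initial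
algebra of `R` is generated, as a `K`-algebra, by the initial terms of the elements of `S`. -/
def MonomialOrder.IsSagbiBasis {σ K : Type*} [Field K] (m : MonomialOrder σ)
    (R : Subalgebra K (MvPolynomial σ K)) (S : Set (MvPolynomial σ K)) : Prop :=
  S ⊆ R ∧ m.initialAlgebra R = Algebra.adjoin K (m.leadingTerm '' S)

/-- A term order on the polynomial ring in the entries of a generic `r × n` matrix is diagonal
(over `K`) if the initial term of every minor is the product of the entries on
its main diagonal. -/
def MonomialOrder.IsDiagonal (K : Type*) [Field K] {r n : ℕ}
    (m : MonomialOrder (Fin r × Fin n)) : Prop :=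
  ∀ (p : ℕ) (a : Fin p ↪o Fin r) (b : Fin p ↪o Fin n),
    m.leadingTerm ((Matrix.mvPolynomialX (Fin r) (Fin n) K).submatrix a b).det
      = ∏ i, X (a i, b i)

/-! ### Hibi rings -/

/-- The Hibi ideal of a distributive lattice. -/
noncomputable def hibiIdeal (K : Type*) [Field K] (L : Type*) [DistribLattice L] : Ideal (MvPolynomial L K) :=
  Ideal.span {f | ∃ x y : L, ¬ x ≤ y ∧ ¬ y ≤ x ∧ f = X x * X y - X (x ⊓ y) * X (x ⊔ y)}

/-- The Hibi ring of a distributive lattice. -/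
abbrev HibiRing (K : Type*) [Field K] (L : Type*) [DistribLattice L] : Type _ :=
  MvPolynomial L K ⧸ hibiIdeal K L

/-! ### The lattice of minors -/

/-- The index `[a₁, …, a_p]`, with `a₁ < ⋯ < a_p` and `p ∈ M`, of a minor in `L(M, n)`. -/
structure FlagMinor (M : Finset ℕ) (n : ℕ) where
  /-- the size of the minor -/
  size : ℕ
  size_mem : size ∈ M
  /-- the column indices -/
  col : Fin size ↪o Fin n

namespace FlagMinor

variable {M : Finset ℕ} {n : ℕ}

/-- `[a₁, …, a_p] ≤ [b₁, …, b_q]` if `p ≥ q` and `aᵢ ≤ bᵢ` for `i = 1, …, q`. -/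
instance : LE (FlagMinor M n) :=
  ⟨fun a b => ∃ h : b.size ≤ a.size, ∀ i : Fin b.size, a.col (Fin.castLE h i) ≤ b.col i⟩

/-- The sequence of column indices, continued by `⊤`. -/
def ext (a : FlagMinor M n) (i : ℕ) : WithTop (Fin n) :=
  if h : i < a.size then (a.col ⟨i, h⟩ : WithTop (Fin n)) else ⊤

theorem ext_of_lt (a : FlagMinor M n) {i : ℕ} (h : i < a.size) :
    a.ext i = (a.col ⟨i, h⟩ : WithTop (Fin n)) := dif_pos h

theorem ext_of_le (a : FlagMinor M n) {i : ℕ} (h : a.size ≤ i) : a.ext i = ⊤ :=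
  dif_neg (not_lt.mpr h)

theorem ext_injective : Function.Injective (ext : FlagMinor M n → ℕ → WithTop (Fin n)) := by
  have key : ∀ a b : FlagMinor M n, a.ext = b.ext → b.size ≤ a.size := by
    intro a b h
    by_contra hlt
    have h1 := congrFun h a.size
    rw [a.ext_of_le le_rfl, b.ext_of_lt (not_le.mp hlt)] at h1
    exact WithTop.top_ne_coe h1
  intro a b h
  have hs : a.size = b.size := le_antisymm (key b a h.symm) (key a b h)
  obtain ⟨p, hp, a⟩ := a
  obtain ⟨q, hq, b⟩ := b
  obtain rfl : p = q := hs
  congr 1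
  ext i : 1
  have h1 := congrFun h i
  rw [ext_of_lt _ i.2, ext_of_lt _ i.2] at h1
  exact WithTop.coe_injective h1

theorem ext_le_iff {a b : FlagMinor M n} : a.ext ≤ b.ext ↔ a ≤ b := by
  constructor
  · intro h
    have hs : b.size ≤ a.size := by
      by_contra hlt
      have h1 := h a.size
      rw [a.ext_of_le le_rfl, b.ext_of_lt (not_le.mp hlt)] at h1
      exact WithTop.coe_ne_top (top_le_iff.mp h1)
    refine ⟨hs, fun i => ?_⟩
    have h1 := h i
    rw [b.ext_of_lt i.2, a.ext_of_lt (i.2.trans_le hs)] at h1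
    exact WithTop.coe_le_coe.mp h1
  · rintro ⟨hs, h⟩ i
    by_cases hi : i < b.size
    · rw [b.ext_of_lt hi, a.ext_of_lt (hi.trans_le hs)]
      exact WithTop.coe_le_coe.mpr (h ⟨i, hi⟩)
    · rw [b.ext_of_le (not_lt.mp hi)]
      exact le_top

instance : PartialOrder (FlagMinor M n) where
  le_refl _ := ext_le_iff.mp le_rfl
  le_trans _ _ _ h1 h2 := ext_le_iff.mp ((ext_le_iff.mpr h1).trans (ext_le_iff.mpr h2))
  le_antisymm _ _ h1 h2 := ext_injective (le_antisymm (ext_le_iff.mpr h1) (ext_le_iff.mpr h2))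

theorem ext_lt_ext (a : FlagMinor M n) {i j : ℕ} (hij : i < j) (hi : i < a.size) :
    a.ext i < a.ext j := by
  rw [a.ext_of_lt hi]
  by_cases hj : j < a.size
  · rw [a.ext_of_lt hj]
    exact WithTop.coe_lt_coe.mpr (a.col.strictMono hij)
  · rw [a.ext_of_le (not_lt.mp hj)]
    exact WithTop.coe_lt_top _

/-- The minor with a given finite, strictly increasing sequence of column indices. -/
theorem exists_ext_eq (f : ℕ → WithTop (Fin n)) (p : ℕ) (hp : p ∈ M)
    (hlt : ∀ i j, i < j → j < p → f i < f j) (hfin : ∀ i < p, f i ≠ ⊤)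
    (htop : ∀ i, p ≤ i → f i = ⊤) : ∃ a : FlagMinor M n, a.ext = f := by
  refine ⟨⟨p, hp, OrderEmbedding.ofStrictMono (fun i => (f i).untop (hfin i i.2)) ?_⟩, ?_⟩
  · intro i j hij
    rw [← WithTop.coe_lt_coe, WithTop.coe_untop, WithTop.coe_untop]
    exact hlt i j hij j.2
  · funext i
    by_cases hi : i < p
    · rw [ext_of_lt _ hi]
      exact WithTop.coe_untop _ (hfin i hi)
    · rw [ext_of_le _ (not_lt.mp hi), htop i (not_lt.mp hi)]

/-- The meet: `p ≥ q`-minors `[a₁, …, a_p]` and `[b₁, …, b_q]` have meet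
`[min a₁ b₁, …, min a_q b_q, a_{q+1}, …, a_p]`. -/
theorem exists_inf (a b : FlagMinor M n) : ∃ c : FlagMinor M n, c.ext = a.ext ⊓ b.ext := by
  refine exists_ext_eq _ (max a.size b.size) ?_ ?_ ?_ ?_
  · rcases max_choice a.size b.size with h | h <;> rw [h]
    exacts [a.size_mem, b.size_mem]
  · intro i j hij hj
    simp only [Pi.inf_apply]
    rcases le_or_gt a.size i with ha | ha
    · rw [a.ext_of_le ha, a.ext_of_le (ha.trans hij.le), top_inf_eq, top_inf_eq]
      exact b.ext_lt_ext hij (by omega)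
    · rcases le_or_gt b.size i with hb | hb
      · rw [b.ext_of_le hb, b.ext_of_le (hb.trans hij.le), inf_top_eq, inf_top_eq]
        exact a.ext_lt_ext hij ha
      · exact min_lt_min (a.ext_lt_ext hij ha) (b.ext_lt_ext hij hb)
  · intro i hi
    simp only [Pi.inf_apply]
    rcases lt_max_iff.mp hi with h | h
    · rw [a.ext_of_lt h]
      exact (lt_of_le_of_lt inf_le_left (WithTop.coe_lt_top _)).ne
    · rw [b.ext_of_lt h]
      exact (lt_of_le_of_lt inf_le_right (WithTop.coe_lt_top _)).ne
  · intro i hi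
    simp only [Pi.inf_apply]
    rw [a.ext_of_le ((le_max_left _ _).trans hi), b.ext_of_le ((le_max_right _ _).trans hi),
      top_inf_eq]

/-- The join: `p ≥ q`-minors `[a₁, …, a_p]` and `[b₁, …, b_q]` have join
`[max a₁ b₁, …, max a_q b_q]`. -/
theorem exists_sup (a b : FlagMinor M n) : ∃ c : FlagMinor M n, c.ext = a.ext ⊔ b.ext := by
  refine exists_ext_eq _ (min a.size b.size) ?_ ?_ ?_ ?_
  · rcases min_choice a.size b.size with h | h <;> rw [h]
    exacts [a.size_mem, b.size_mem]
  · intro i j hij hj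
    simp only [Pi.sup_apply]
    exact max_lt_max (a.ext_lt_ext hij (by omega)) (b.ext_lt_ext hij (by omega))
  · intro i hi
    simp only [Pi.sup_apply]
    rw [a.ext_of_lt (by omega), b.ext_of_lt (by omega)]
    exact (sup_lt_iff.mpr ⟨WithTop.coe_lt_top _, WithTop.coe_lt_top _⟩).ne
  · intro i hi
    simp only [Pi.sup_apply]
    rcases min_le_iff.mp hi with h | h
    · rw [a.ext_of_le h, top_sup_eq]
    · rw [b.ext_of_le h, sup_top_eq]

noncomputable instance : Min (FlagMinor M n) := ⟨fun a b => (exists_inf a b).choose⟩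

noncomputable instance : Max (FlagMinor M n) := ⟨fun a b => (exists_sup a b).choose⟩

theorem ext_inf (a b : FlagMinor M n) : (a ⊓ b).ext = a.ext ⊓ b.ext := (exists_inf a b).choose_spec

theorem ext_sup (a b : FlagMinor M n) : (a ⊔ b).ext = a.ext ⊔ b.ext := (exists_sup a b).choose_spec

/-- `L(M, n)` is a distributive lattice; the operations are determined by the partial order. -/
noncomputable instance : DistribLattice (FlagMinor M n) where
  inf := (· ⊓ ·)
  sup := (· ⊔ ·)
  inf_le_left a b := ext_le_iff.mp ((ext_inf a b).le.trans inf_le_left)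
  inf_le_right a b := ext_le_iff.mp ((ext_inf a b).le.trans inf_le_right)
  le_inf a b c h1 h2 := ext_le_iff.mp
    ((le_inf (ext_le_iff.mpr h1) (ext_le_iff.mpr h2)).trans (ext_inf b c).ge)
  le_sup_left a b := ext_le_iff.mp (le_sup_left.trans (ext_sup a b).ge)
  le_sup_right a b := ext_le_iff.mp (le_sup_right.trans (ext_sup a b).ge)
  sup_le a b c h1 h2 := ext_le_iff.mp
    ((ext_sup a b).le.trans (sup_le (ext_le_iff.mpr h1) (ext_le_iff.mpr h2)))
  le_sup_inf a b c := ext_le_iff.mp (by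
    simp only [ext_inf, ext_sup]
    exact le_sup_inf)

/-- The minor of the generic `m_k × n` matrix, `m_k = max M`, with row indices `1, …, p` and
column indices `a₁, …, a_p`. -/
noncomputable def minor (K : Type*) [Field K] (a : FlagMinor M n) :
    MvPolynomial (Fin (M.sup id) × Fin n) K :=
  ((Matrix.mvPolynomialX (Fin (M.sup id)) (Fin n) K).submatrix
    (Fin.castLE (Finset.le_sup (f := id) a.size_mem)) a.col).det

end FlagMinor

/-- The coordinate ring `Flag(M, n)`: the `K`-algebra generated by the minors in `L(M, n)`. -/
noncomputable def flagAlgebra (K : Type*) [Field K] (M : Finset ℕ) (n : ℕ) :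
    Subalgebra K (MvPolynomial (Fin (M.sup id) × Fin n) K) :=
  Algebra.adjoin K (Set.range (FlagMinor.minor K : FlagMinor M n → _))

/-- The weakly increasing sequences `δ₁ ≤ δ₂ ≤ ⋯ ≤ δ_v` (`v ≥ 0`) in `L(M, n)`. -/
abbrev StandardSeq (M : Finset ℕ) (n : ℕ) : Type :=
  {l : List (FlagMinor M n) // l.Pairwise (· ≤ ·)}

/-- The standard monomial `δ₁ ⋯ δ_v`, an element of `B(M, n)`. -/
noncomputable def standardMonomial (K : Type*) [Field K] {M : Finset ℕ} {n : ℕ}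
    (l : StandardSeq M n) : MvPolynomial (Fin (M.sup id) × Fin n) K :=
  (l.1.map (FlagMinor.minor K)).prod

/-! Two facts carry the proof: standard monomials span `Flag(M, n)`, and their initial terms are
pairwise distinct monomials with coefficient 1.

Spanning is straightening. If `b` is no longer than `a` and `b_i < a_i`, then `a_i, …, a_p` and
`b_1, …, b_i` are `p + 1` columns of height `p`, so alternating the product of the two minors over
them gives zero. Every term other than the original product moves some small column of `b` into `a`,
which lowers the column sum of the first factor and keeps both sizes (`minor_mul_minor_mem_span`).
Induction then straightens any product sorted by decreasing size.

Distinctness holds because the first factor of a standard monomial can be read off its diagonal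
exponents: in each row its entry is the smallest column that occurs (`sum_diagExponent_injective`).

Hence no two leading terms cancel in a combination of standard monomials, and the initial algebra
has the stated basis and generators. Meet and join are rowwise minimum and maximum, so the Hibi
relations hold among initial terms. The Hibi ring is itself spanned by standard products, whose
images are independent, so the map from it is injective. -/

/-! ### Straightening -/

section Straightening

variable {K A L : Type*} [Field K] [CommRing A] [Algebra K A] [PartialOrder L]

/-- If all the products `f a * f b` with `s b ≤ s a` and `¬ a ≤ b` can be rewritten with smaller
first factors, without changing the values of `s`, then every product of values of `f` along a
list on which `s` is decreasing is a linear combination of standard products. -/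
theorem prod_mem_span_standard_of_shape (f : L → A) (s : L → ℕ) {r : L → L → Prop}
    (hr : WellFounded r)
    (h : ∀ a b, s b ≤ s a → ¬ a ≤ b → f a * f b ∈ Submodule.span K
      {x | ∃ a' b', r a' a ∧ s a' = s a ∧ s b' = s b ∧ x = f a' * f b'})
    (t : List ℕ) (ht : t.Pairwise (· ≥ ·)) (l : List L) (hl : l.map s = t) :
    (l.map f).prod ∈ Submodule.span K
      {x | ∃ l' : List L, l'.Pairwise (· ≤ ·) ∧ l'.map s = t ∧ x = (l'.map f).prod} := by
  induction t generalizing l with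
  | nil =>
    obtain rfl : l = [] := by simpa using hl
    exact Submodule.subset_span ⟨[], by simp, by simp, rfl⟩
  | cons p t ih =>
    obtain ⟨a, l, rfl, rfl, hlt⟩ : ∃ a l', l = a :: l' ∧ s a = p ∧ l'.map s = t := by
      cases l with
      | nil => simp at hl
      | cons a l => exact ⟨a, l, rfl, by simpa using hl⟩
    have ht' := (List.pairwise_cons.mp ht).2
    -- Inner induction on the first factor along `r`, the tail being already standard.
    have inner : ∀ c, s c = s a → ∀ x ∈ Submodule.span K
        {x | ∃ l' : List L, l'.Pairwise (· ≤ ·) ∧ l'.map s = t ∧ x = (l'.map f).prod},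
        f c * x ∈ Submodule.span K {x | ∃ l' : List L,
          l'.Pairwise (· ≤ ·) ∧ l'.map s = s a :: t ∧ x = (l'.map f).prod} := by
      intro c
      induction c using hr.induction with
      | _ c ihc =>
      intro hc x hx
      induction hx using Submodule.span_induction with
      | zero => simp
      | add x y _ _ hx hy => rw [mul_add]; exact add_mem hx hy
      | smul k x _ hx => rw [mul_smul_comm]; exact Submodule.smul_mem _ _ hx
      | mem x hx =>
      obtain ⟨l', hstd, hsh, rfl⟩ := hx
      cases l' with
      | nil => exact Submodule.subset_span ⟨[c], by simp, by simpa [hc] using hsh, by simp⟩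
      | cons b l' =>
        by_cases hcb : c ≤ b
        · refine Submodule.subset_span ⟨c :: b :: l', ?_, by rw [List.map_cons, hsh, hc], by simp⟩
          refine List.pairwise_cons.mpr ⟨fun d hd => ?_, hstd⟩
          rcases List.mem_cons.mp hd with rfl | hd
          exacts [hcb, hcb.trans ((List.pairwise_cons.mp hstd).1 d hd)]
        · have hsb : s b ≤ s c := by
            rw [hc]
            exact (List.pairwise_cons.mp ht).1 _ (by rw [← hsh]; simp)
          have key := h c b hsb hcb
          rw [List.map_cons, List.prod_cons, ← mul_assoc]
          generalize f c * f b = y at key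
          induction key using Submodule.span_induction with
          | zero => simp
          | add x y _ _ hx hy => rw [add_mul]; exact add_mem hx hy
          | smul k x _ hx => rw [smul_mul_assoc]; exact Submodule.smul_mem _ _ hx
          | mem x hx =>
          obtain ⟨a', b', hra, hsa, hsb', rfl⟩ := hx
          -- The new second factor may spoil the order of the tail, but not its shape, so the outer
          -- induction straightens the tail again.
          have := ih ht' (b' :: l') (by rw [← hsh, List.map_cons, List.map_cons, hsb'])
          have := ihc a' hra (hsa.trans hc) _ this
          rwa [List.map_cons, List.prod_cons, ← mul_assoc] at this
    rw [List.map_cons, List.prod_cons]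
    exact inner a rfl _ (ih ht' l hlt)

/-- Under the assumptions of `prod_mem_span_standard_of_shape`, the subalgebra generated by the
values of `f` is spanned by the standard products. -/
theorem adjoin_range_le_span_standard (f : L → A) (s : L → ℕ) {r : L → L → Prop}
    (hr : WellFounded r)
    (h : ∀ a b, s b ≤ s a → ¬ a ≤ b → f a * f b ∈ Submodule.span K
      {x | ∃ a' b', r a' a ∧ s a' = s a ∧ s b' = s b ∧ x = f a' * f b'}) :
    Subalgebra.toSubmodule (Algebra.adjoin K (Set.range f)) ≤
      Submodule.span K (Set.range
        fun l : {l : List L // l.Pairwise (· ≤ ·)} => (l.1.map f).prod) := by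
  rw [Algebra.adjoin_eq_span, Submodule.span_le]
  intro x hx
  obtain ⟨l, rfl⟩ : ∃ l : List L, x = (l.map f).prod := by
    induction hx using Submonoid.closure_induction with
    | mem x hx => obtain ⟨a, rfl⟩ := hx; exact ⟨[a], by simp⟩
    | one => exact ⟨[], by simp⟩
    | mul x y _ _ hx hy =>
      obtain ⟨l, rfl⟩ := hx
      obtain ⟨l', rfl⟩ := hy
      exact ⟨l ++ l', by simp⟩
  classical
  -- Since `A` is commutative, the factors may be sorted by decreasing `s`.
  let R : L → L → Prop := fun a b => s b ≤ s a
  have : Std.Total R := ⟨fun a b => le_total (s b) (s a)⟩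
  have : IsTrans L R := ⟨fun a b c hab hbc => le_trans hbc hab⟩
  have hs := List.pairwise_insertionSort R l
  have hp := ((List.perm_insertionSort R l).map f).prod_eq
  rw [← hp]
  refine Submodule.span_mono ?_
    (prod_mem_span_standard_of_shape (K := K) f s hr h _ ?_ (l.insertionSort R) rfl)
  · rintro _ ⟨l', hl', -, rfl⟩
    exact ⟨⟨l', hl'⟩, rfl⟩
  · exact List.pairwise_map.mpr hs

end Straightening

/-! ### The exchange relation -/

section Exchange

variable {K R : Type*} [Field K] [CommRing R] [IsDomain R] [Algebra K R]

/-- Alternating forms `f` and `g` on `R ^ p` in more than `p` variables altogether satisfy a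
Plücker relation: `f v * g w` is a signed sum of products obtained by exchanging at least one
of the vectors in `v` with a vector in `w`. -/
theorem mul_mem_span_exchange {p : ℕ} {α β : Type*} [Fintype α] [Fintype β]
    [DecidableEq α] [DecidableEq β] (f : (Fin p → R) [⋀^α]→ₗ[R] R) (g : (Fin p → R) [⋀^β]→ₗ[R] R)
    (v : α ⊕ β → Fin p → R) (hcard : p < Fintype.card (α ⊕ β)) :
    f (fun i => v (.inl i)) * g (fun i => v (.inr i)) ∈ Submodule.span K
      {x | ∃ σ : Equiv.Perm (α ⊕ β), (∃ i j, σ (.inl i) = .inr j) ∧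
        x = f (fun i => v (σ (.inl i))) * g (fun i => v (σ (.inr i)))} := by
  classical
  -- An alternating form vanishes on more than `p` vectors of `R ^ p`, as these are dependent.
  have h0 : (LinearMap.mul' R R).compAlternatingMap (f.domCoprod g) v = 0 := by
    refine AlternatingMap.map_linearDependent _ _ fun hli => ?_
    have := hli.fintype_card_le_finrank
    simp at this hcard
    omega
  rw [LinearMap.compAlternatingMap_apply, AlternatingMap.domCoprod_apply, _root_.sum_apply,
    map_sum] at h0
  replace h0 := (Finset.add_sum_erase _ _
    (@Finset.mem_univ _ _ (Quotient.mk'' 1 : Equiv.Perm.ModSumCongr α β))).trans h0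
  have h1 : f (fun i => v (.inl i)) * g (fun i => v (.inr i)) =
      LinearMap.mul' R R (AlternatingMap.domCoprod.summand f g (Quotient.mk'' 1) v) := by
    simp [AlternatingMap.domCoprod.summand_mk'']
  rw [h1, eq_neg_of_add_eq_zero_left h0]
  refine neg_mem (Submodule.sum_mem _ fun q hq => ?_)
  induction q using Quotient.inductionOn' with | _ σ
  -- A permutation preserving the two blocks represents the trivial coset, whose term was split off.
  have hσ : ∃ i j, σ (.inl i) = .inr j := by
    by_contra! hne
    refine (Finset.mem_erase.mp hq).1 (Eq.symm ?_)
    rw [Quotient.eq'', QuotientGroup.leftRel_apply, inv_one, one_mul]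
    refine Equiv.Perm.mem_sumCongrHom_range_of_perm_mapsTo_inl ?_
    rintro _ ⟨i, rfl⟩
    rcases hi : σ (.inl i) with j | j
    exacts [⟨j, rfl⟩, (hne i j hi).elim]
  have h2 : LinearMap.mul' R R (AlternatingMap.domCoprod.summand f g (Quotient.mk'' σ) v) =
      Equiv.Perm.sign σ • (f (fun i => v (σ (.inl i))) * g (fun i => v (σ (.inr i)))) := by
    rw [AlternatingMap.domCoprod.summand_mk'']
    rcases Int.units_eq_one_or (Equiv.Perm.sign σ) with h | h <;> simp [h]
  rw [h2]
  have h3 := Submodule.subset_span (R := K) (show f (fun i => v (σ (.inl i))) *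
    g (fun i => v (σ (.inr i))) ∈ {x | ∃ σ : Equiv.Perm (α ⊕ β), (∃ i j, σ (.inl i) = .inr j) ∧
        x = f (fun i => v (σ (.inl i))) * g (fun i => v (σ (.inr i)))} from ⟨σ, hσ, rfl⟩)
  rcases Int.units_eq_one_or (Equiv.Perm.sign σ) with h | h <;> simpa [h] using h3

end Exchange

/-! ### Straightening of products of minors -/

theorem sumElim_update_comp {ι κ γ V : Type*} [DecidableEq ι] [DecidableEq γ] (e : γ ≃ ι ⊕ κ)
    (u : κ → V) (v : ι → V) (i : ι) (z : V) :
    (fun j => Sum.elim (Function.update v i z) u (e j)) =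
      Function.update (fun j => Sum.elim v u (e j)) (e.symm (.inl i)) z := by
  funext j
  obtain ⟨k, rfl⟩ := e.symm.surjective j
  rcases k with k | k <;> simp [Function.update_apply]

/-- The determinant as an alternating form in some of the vectors, the others being fixed. -/
def detForm {R ι κ : Type*} [CommRing R] {p : ℕ}
    (e : Fin p ≃ ι ⊕ κ) (u : κ → Fin p → R) : (Fin p → R) [⋀^ι]→ₗ[R] R :=
  AlternatingMap.mk
    { toFun := fun v => Matrix.detRowAlternating fun j => Sum.elim v u (e j)
      map_update_add' := by
        intro _ v i x y
        simp only [sumElim_update_comp, AlternatingMap.map_update_add]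
      map_update_smul' := by
        intro _ v i c x
        simp only [sumElim_update_comp, AlternatingMap.map_update_smul] }
    (by
      intro v i j hv hij
      refine Matrix.detRowAlternating.map_eq_zero_of_eq (i := e.symm (.inl i))
        (j := e.symm (.inl j)) _ (by simpa using hv) (by simpa using hij))

/-- Exchanging large with small elements decreases the sum. -/
theorem sum_exchange_lt {α β : Type*} [Fintype α] [Fintype β] (w : α ⊕ β → ℕ) (t : ℕ)
    (hl : ∀ x, t ≤ w (.inl x)) (hr : ∀ y, w (.inr y) < t) (σ : Equiv.Perm (α ⊕ β))
    (hσ : ∃ i j, σ (.inl i) = .inr j) : ∑ x, w (σ (.inl x)) < ∑ x, w (.inl x) := by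
  obtain ⟨i, j, hij⟩ := hσ
  -- Truncated subtraction measures the excess over `t`. Only left elements can have any, so a
  -- permutation cannot increase the left total; an element below `t` moved to the left makes this
  -- inequality strict.
  have h1 : ∑ x, w (σ (.inl x)) < ∑ x, ((w (σ (.inl x)) - t) + t) := by
    refine Finset.sum_lt_sum (fun x _ => by omega) ⟨i, Finset.mem_univ _, ?_⟩
    have := hr j
    rw [hij]
    omega
  have h2 : ∑ x, (w (σ (.inl x)) - t) ≤ ∑ x, (w (.inl x) - t) :=
    calc ∑ x, (w (σ (.inl x)) - t) ≤ ∑ z, (w (σ z) - t) := by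
          rw [Fintype.sum_sum_type]; exact Nat.le_add_right _ _
      _ = ∑ z, (w z - t) := Equiv.sum_comp σ fun z => w z - t
      _ = ∑ x, (w (.inl x) - t) := by
          rw [Fintype.sum_sum_type, add_eq_left]
          exact Finset.sum_eq_zero fun y _ => by have := hr y; omega
  have h3 : ∑ x, w (.inl x) = ∑ x, ((w (.inl x) - t) + t) :=
    Finset.sum_congr rfl fun x _ => by have := hl x; omega
  rw [Finset.sum_add_distrib] at h1 h3
  omega

namespace FlagMinor

variable {M : Finset ℕ} {n : ℕ}

/-- The sum of the column indices. -/
def weight (a : FlagMinor M n) : ℕ := ∑ j, (a.col j : ℕ)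

/-- A determinant of columns of the first `p` rows of the generic matrix vanishes or is, up to
sign, one of the minors in `L(M, n)`. -/
theorem det_eq_zero_or_minor (K : Type*) [Field K] {p : ℕ} (hp : p ∈ M) (c : Fin p → Fin n) :
    ((Matrix.mvPolynomialX (Fin (M.sup id)) (Fin n) K).submatrix
      (Fin.castLE (Finset.le_sup (f := id) hp)) c).det = 0 ∨
    ∃ a : FlagMinor M n, a.size = p ∧ a.weight = ∑ j, (c j : ℕ) ∧
      (((Matrix.mvPolynomialX (Fin (M.sup id)) (Fin n) K).submatrix
        (Fin.castLE (Finset.le_sup (f := id) hp)) c).det = a.minor K ∨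
      ((Matrix.mvPolynomialX (Fin (M.sup id)) (Fin n) K).submatrix
        (Fin.castLE (Finset.le_sup (f := id) hp)) c).det = - a.minor K) := by
  by_cases hc : Function.Injective c
  · right
    have hs : StrictMono (c ∘ Tuple.sort c) :=
      (Tuple.monotone_sort c).strictMono_of_injective (hc.comp (Tuple.sort c).injective)
    refine ⟨⟨p, hp, OrderEmbedding.ofStrictMono _ hs⟩, rfl, ?_, ?_⟩
    · exact Equiv.sum_comp (Tuple.sort c) fun j => (c j : ℕ)
    · have h := Matrix.det_permute' (Tuple.sort c)
        ((Matrix.mvPolynomialX (Fin (M.sup id)) (Fin n) K).submatrix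
          (Fin.castLE (Finset.le_sup (f := id) hp)) c)
      rw [Matrix.submatrix_submatrix] at h
      have h' : (⟨p, hp, OrderEmbedding.ofStrictMono _ hs⟩ : FlagMinor M n).minor K = _ := h
      rw [h']
      rcases Int.units_eq_one_or (Equiv.Perm.sign (Tuple.sort c)) with h | h <;> simp [h]
  · left
    rw [Function.Injective] at hc
    push Not at hc
    obtain ⟨i, j, hij, hne⟩ := hc
    exact Matrix.det_zero_of_column_eq hne fun k => by simp [hij]

/-- The straightening relation for a product of two minors. -/
theorem minor_mul_minor_mem_span (K : Type*) [Field K] (a b : FlagMinor M n)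
    (hs : b.size ≤ a.size) (hab : ¬ a ≤ b) :
    a.minor K * b.minor K ∈ Submodule.span K
      {x | ∃ a' b' : FlagMinor M n, a'.weight < a.weight ∧ a'.size = a.size ∧ b'.size = b.size ∧
        x = a'.minor K * b'.minor K} := by
  obtain ⟨i, hi⟩ : ∃ i : Fin b.size, b.col i < a.col (Fin.castLE hs i) := by
    by_contra! h
    exact hab ⟨hs, h⟩
  set i' := Fin.castLE hs i with hi'
  -- The left blocks, `a_i, …, a_p` and `b_1, …, b_i`, take part in the exchange; the other columns
  -- stay fixed.
  let e₁ : Fin a.size ≃ {j // i' ≤ j} ⊕ {j // ¬ i' ≤ j} := (Equiv.sumCompl fun j => i' ≤ j).symm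
  let e₂ : Fin b.size ≃ {j // j ≤ i} ⊕ {j // ¬ j ≤ i} := (Equiv.sumCompl fun j => j ≤ i).symm
  let ra := Fin.castLE (Finset.le_sup (f := id) a.size_mem)
  let rb := Fin.castLE (Finset.le_sup (f := id) b.size_mem)
  let x : Fin n → Fin a.size → MvPolynomial (Fin (M.sup id) × Fin n) K := fun c r => X (ra r, c)
  let y : Fin n → Fin b.size → MvPolynomial (Fin (M.sup id) × Fin n) K := fun c r => X (rb r, c)
  let f := detForm e₁ fun j => x (a.col j)
  -- The shorter minor uses only the top rows, so its form is pulled back along the projection that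
  -- forgets the others.
  let g := (detForm e₂ fun j => y (b.col j)).compLinearMap
    (LinearMap.funLeft (MvPolynomial (Fin (M.sup id) × Fin n) K) _ (Fin.castLE hs))
  have hf : ∀ c : {j // i' ≤ j} → Fin n, f (fun j => x (c j)) =
      ((Matrix.mvPolynomialX (Fin (M.sup id)) (Fin n) K).submatrix ra
        (fun j => Sum.elim c (fun j : {j // ¬ i' ≤ j} => a.col j) (e₁ j))).det := by
    intro c
    rw [← Matrix.det_transpose]
    refine congrArg Matrix.det ?_
    ext j r
    rcases h : e₁ j with k | k <;> simp [h, x]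
  have hg : ∀ c : {j // j ≤ i} → Fin n, g (fun j => x (c j)) =
      ((Matrix.mvPolynomialX (Fin (M.sup id)) (Fin n) K).submatrix rb
        (fun j => Sum.elim c (fun j : {j // ¬ j ≤ i} => b.col j) (e₂ j))).det := by
    intro c
    rw [← Matrix.det_transpose]
    refine congrArg Matrix.det ?_
    ext j r
    rcases h : e₂ j with k | k <;> simp [h, x, y, ra, rb, LinearMap.funLeft]
  let w : {j // i' ≤ j} ⊕ {j // j ≤ i} → Fin n := Sum.elim (fun j => a.col j) (fun j => b.col j)
  -- With `i` counted from 0, the blocks have `a.size - i` and `i + 1` elements, one more than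
  -- `a.size` in total.
  have key := mul_mem_span_exchange (K := K) f g (fun j => x (w j)) (by
    have h1 := Fin.card_Ici i'
    have h2 := Fin.card_Iic i
    rw [Fintype.card_sum, Fintype.card_of_subtype (Finset.Ici i') (by simp),
      Fintype.card_of_subtype (Finset.Iic i) (by simp), h1, h2, hi', Fin.val_castLE]
    omega)
  rw [hf, hg] at key
  have ha : (fun j => Sum.elim (fun i => w (.inl i)) (fun j : {j // ¬ i' ≤ j} => a.col j) (e₁ j)) = a.col := by
    funext j
    obtain ⟨k, rfl⟩ := e₁.symm.surjective j
    rcases k with k | k <;> simp [w, e₁]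
  have hb : (fun j => Sum.elim (fun i => w (.inr i)) (fun j : {j // ¬ j ≤ i} => b.col j) (e₂ j)) = b.col := by
    funext j
    obtain ⟨k, rfl⟩ := e₂.symm.surjective j
    rcases k with k | k <;> simp [w, e₂]
  rw [ha, hb] at key
  refine Submodule.span_le.mpr ?_ key
  rintro _ ⟨σ, hσ, rfl⟩
  rw [hf, hg, SetLike.mem_coe]
  -- The threshold `a_i` separates the blocks: `b_j ≤ b_i < a_i` for `j ≤ i`.
  have hw := sum_exchange_lt (fun j => (w j : ℕ)) (a.col i') (fun j => ?_) (fun j => ?_) σ hσ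
  · rcases det_eq_zero_or_minor K a.size_mem
      (fun j => Sum.elim (fun i => w (σ (.inl i))) (fun j : {j // ¬ i' ≤ j} => a.col j) (e₁ j)) with
      h | ⟨a', ha', hwa, h⟩
    · rw [h, zero_mul]; exact zero_mem _
    rcases det_eq_zero_or_minor K b.size_mem
      (fun j => Sum.elim (fun i => w (σ (.inr i))) (fun j : {j // ¬ j ≤ i} => b.col j) (e₂ j)) with
      h' | ⟨b', hb', -, h'⟩
    · rw [h', mul_zero]; exact zero_mem _
    have hmem : a'.minor K * b'.minor K ∈ Submodule.span K
      {x | ∃ a' b' : FlagMinor M n, a'.weight < a.weight ∧ a'.size = a.size ∧ b'.size = b.size ∧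
        x = a'.minor K * b'.minor K} := by
      refine Submodule.subset_span ⟨a', b', ?_, ha', hb', rfl⟩
      rw [hwa, weight, ← Equiv.sum_comp e₁.symm, ← Equiv.sum_comp e₁.symm, Fintype.sum_sum_type,
        Fintype.sum_sum_type]
      simpa [e₁, w] using hw
    rcases h with h | h <;> rcases h' with h' | h' <;> rw [h, h'] <;> simpa using hmem
  · exact a.col.monotone j.2
  · exact (b.col.monotone j.2).trans_lt hi

instance : Finite (FlagMinor M n) :=
  Finite.of_injective (β := Σ p : M, Fin p ↪o Fin n) (fun a => ⟨⟨a.size, a.size_mem⟩, a.col⟩) (by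
    rintro ⟨p, hp, a⟩ ⟨q, hq, b⟩ h
    obtain ⟨h1, h2⟩ := Sigma.mk.inj_iff.mp h
    obtain rfl : p = q := congrArg Subtype.val h1
    cases eq_of_heq h2
    rfl)

theorem flagAlgebra_le_span (K : Type*) [Field K] :
    Subalgebra.toSubmodule (flagAlgebra K M n) ≤
      Submodule.span K (Set.range (standardMonomial K : StandardSeq M n → _)) :=
  adjoin_range_le_span_standard _ size (measure weight).wf (minor_mul_minor_mem_span K)

/-- Here straightening is the Hibi relation itself: the first factor drops to the meet. No shape is
needed, so `s` is constant. -/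
theorem hibiRing_span_eq_top (K : Type*) [Field K] :
    Submodule.span K (Set.range fun l : StandardSeq M n => (l.1.map fun a =>
      Ideal.Quotient.mk (hibiIdeal K (FlagMinor M n)) (X a)).prod) = ⊤ := by
  rw [eq_top_iff]
  refine le_trans ?_ (adjoin_range_le_span_standard (K := K)
    (fun a => Ideal.Quotient.mk (hibiIdeal K (FlagMinor M n)) (X a)) (fun _ => 0)
    (wellFounded_lt (α := FlagMinor M n)) ?_)
  · rw [← Algebra.top_toSubmodule]
    have h := congrArg (Subalgebra.map (Ideal.Quotient.mkₐ K (hibiIdeal K (FlagMinor M n))))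
      (MvPolynomial.adjoin_range_X (R := K) (σ := FlagMinor M n))
    rw [AlgHom.map_adjoin, ← Set.range_comp, Algebra.map_top,
      (AlgHom.range_eq_top _).mpr (Ideal.Quotient.mkₐ_surjective K _)] at h
    exact h.ge
  · intro a b _ hab
    refine Submodule.subset_span ⟨a ⊓ b, a ⊔ b, inf_lt_left.mpr hab, rfl, rfl, ?_⟩
    -- For comparable factors the rewriting merely swaps them.
    by_cases hba : b ≤ a
    · rw [inf_eq_right.mpr hba, sup_eq_left.mpr hba, mul_comm]
    · rw [← map_mul, ← map_mul, Ideal.Quotient.eq]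
      exact Ideal.subset_span ⟨a, b, hab, hba, rfl⟩

end FlagMinor

/-! ### Initial terms of standard monomials -/

section LeadingTerm

variable {σ K : Type*} [Field K] (m : MonomialOrder σ)

theorem leadingTerm_list_prod (l : List (MvPolynomial σ K)) :
    m.leadingTerm l.prod = (l.map m.leadingTerm).prod := by
  induction l with
  | nil => simp [MonomialOrder.leadingTerm]
  | cons a l ih => rw [List.prod_cons, m.leadingTerm_mul, ih, List.map_cons, List.prod_cons]

/-- If the elements of a family have pairwise distinct degrees, then the degree of a nonzero
linear combination is the degree of an element of the family. -/
theorem exists_degree_eq_of_mem_span {ι : Type*} (g : ι → MvPolynomial σ K)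
    (hg : ∀ i, g i ≠ 0) (hinj : Function.Injective fun i => m.degree (g i))
    {f : MvPolynomial σ K} (hf : f ∈ Submodule.span K (Set.range g)) (hf0 : f ≠ 0) :
    ∃ i, m.degree f = m.degree (g i) := by
  obtain ⟨c, rfl⟩ := (Finsupp.mem_span_range_iff_exists_finsupp).mp hf
  have hc : c.support.Nonempty := by
    rw [Finsupp.support_nonempty_iff]
    rintro rfl
    simp at hf0
  -- Degrees are distinct, so the largest one occurs once and cannot cancel.
  obtain ⟨i, hi, hmax⟩ := c.support.exists_max_image (fun i => m.toSyn (m.degree (g i))) hc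
  refine ⟨i, m.toSyn.injective (le_antisymm ?_ ?_)⟩
  · refine m.degree_sum_le.trans (Finset.sup_le fun j hj => ?_)
    exact m.degree_smul_le.trans (hmax j hj)
  · refine m.le_degree (mem_support_iff.mpr ?_)
    rw [Finsupp.sum, coeff_sum, Finset.sum_eq_single i]
    · rw [coeff_smul, smul_eq_mul]
      exact mul_ne_zero (Finsupp.mem_support_iff.mp hi) (m.coeff_degree_ne_zero_iff.mpr (hg i))
    · intro j hj hji
      rw [coeff_smul, m.coeff_eq_zero_of_lt, smul_zero]
      exact lt_of_le_of_ne (hmax j hj) fun h => hji (hinj (m.toSyn.injective h))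
    · exact fun h => (h hi).elim

theorem leadingTerm_mem_span {ι : Type*} (g : ι → MvPolynomial σ K)
    (hg : ∀ i, m.leadingCoeff (g i) = 1) (hinj : Function.Injective fun i => m.degree (g i))
    {f : MvPolynomial σ K} (hf : f ∈ Submodule.span K (Set.range g)) :
    m.leadingTerm f ∈ Submodule.span K (Set.range fun i => m.leadingTerm (g i)) := by
  by_cases hf0 : f = 0
  · simp [hf0]
  have hg0 : ∀ i, g i ≠ 0 := fun i h => by simpa [h] using hg i
  obtain ⟨i, hi⟩ := exists_degree_eq_of_mem_span m g hg0 hinj hf hf0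
  have h : m.leadingTerm f = m.leadingCoeff f • m.leadingTerm (g i) := by
    rw [MonomialOrder.leadingTerm, MonomialOrder.leadingTerm, hi, hg, smul_monomial, smul_eq_mul,
      mul_one]
  rw [h]
  exact Submodule.smul_mem _ _ (Submodule.subset_span ⟨i, rfl⟩)

end LeadingTerm

namespace FlagMinor

variable {M : Finset ℕ} {n : ℕ}

/-- The exponent vector of the main diagonal of a minor. -/
noncomputable def diagExponent (a : FlagMinor M n) : Fin (M.sup id) × Fin n →₀ ℕ :=
  ∑ i, Finsupp.single (Fin.castLE (Finset.le_sup (f := id) a.size_mem) i, a.col i) 1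

/-- The value `⊤` of `ext` is no column, so rows below the minor contribute zero without a case
distinction. -/
theorem diagExponent_apply (a : FlagMinor M n) (i : Fin (M.sup id)) (j : Fin n) :
    a.diagExponent (i, j) = if a.ext i = j then 1 else 0 := by
  classical
  rw [diagExponent, Finsupp.finsetSum_apply]
  by_cases hi : (i : ℕ) < a.size
  · rw [a.ext_of_lt hi, Finset.sum_eq_single ⟨i, hi⟩]
    · have : Fin.castLE (Finset.le_sup (f := id) a.size_mem) ⟨i, hi⟩ = i := Fin.ext rfl
      rw [this]
      simp [Finsupp.single_apply]
    · intro k _ hk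
      rw [Finsupp.single_apply, if_neg]
      intro h
      exact hk (Fin.ext (congrArg (fun x => (x.1 : ℕ)) h))
    · simp
  · rw [a.ext_of_le (not_lt.mp hi), if_neg WithTop.top_ne_coe]
    refine Finset.sum_eq_zero fun k _ => ?_
    rw [Finsupp.single_apply, if_neg]
    intro h
    have : (k : ℕ) = i := congrArg (fun x => (x.1 : ℕ)) h
    exact hi (this ▸ k.2)

theorem leadingTerm_minor {K : Type*} [Field K] {m : MonomialOrder (Fin (M.sup id) × Fin n)}
    (hm : m.IsDiagonal K) (a : FlagMinor M n) :
    m.leadingTerm (a.minor K) = monomial a.diagExponent 1 := by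
  have h := hm a.size (Fin.castLEOrderEmb (Finset.le_sup (f := id) a.size_mem)) a.col
  rw [diagExponent, monomial_sum_one]
  exact h

/-- In each row, minimum and maximum are the two original entries in some order. -/
theorem diagExponent_inf_add_sup (a b : FlagMinor M n) :
    (a ⊓ b).diagExponent + (a ⊔ b).diagExponent = a.diagExponent + b.diagExponent := by
  ext ⟨i, j⟩
  simp only [Finsupp.add_apply, diagExponent_apply, ext_inf, ext_sup, Pi.inf_apply, Pi.sup_apply]
  rcases le_total (a.ext i) (b.ext i) with h | h
  · rw [inf_eq_left.mpr h, sup_eq_right.mpr h]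
  · rw [inf_eq_right.mpr h, sup_eq_left.mpr h, add_comm]

/-- The smallest element of a standard sequence is determined by the support of the exponent
vector: its column indices are the smallest ones that occur in the respective rows. -/
theorem le_of_sum_diagExponent_le (a b : FlagMinor M n) (l l' : List (FlagMinor M n))
    (hb : ∀ c ∈ l', b ≤ c)
    (h : ((a :: l).map diagExponent).sum = (l'.map diagExponent).sum) : b ≤ a := by
  rw [← ext_le_iff]
  intro i
  by_cases hi : i < a.size
  swap
  · rw [a.ext_of_le (not_lt.mp hi)]; exact le_top
  have hi' : i < M.sup id := hi.trans_le (Finset.le_sup (f := id) a.size_mem)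
  have h1 := DFunLike.congr_fun h (⟨i, hi'⟩, a.col ⟨i, hi⟩)
  have h2 : (l'.map diagExponent).sum (⟨i, hi'⟩, a.col ⟨i, hi⟩) ≠ 0 := by
    rw [← h1, List.map_cons, List.sum_cons, Finsupp.add_apply, diagExponent_apply,
      if_pos (a.ext_of_lt hi)]
    omega
  obtain ⟨c, hc, hc'⟩ : ∃ c ∈ l', c.diagExponent (⟨i, hi'⟩, a.col ⟨i, hi⟩) ≠ 0 := by
    by_contra! hne
    refine h2 ?_
    clear h h1 h2 hb
    induction l' with
    | nil => simp
    | cons d l' ih =>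
      rw [List.map_cons, List.sum_cons, Finsupp.add_apply, hne d (by simp),
        ih fun c hc => hne c (by simp [hc])]
  rw [diagExponent_apply] at hc'
  have hc'' : c.ext i = a.col ⟨i, hi⟩ := by
    by_contra hne
    exact hc' (if_neg hne)
  rw [a.ext_of_lt hi, ← hc'']
  exact ext_le_iff.mpr (hb c hc) i

/-- Rules out the empty minor, whose exponent is zero and whose repetitions could not be counted. -/
theorem diagExponent_ne_zero (hM : ∀ p ∈ M, 1 ≤ p) (a : FlagMinor M n) : a.diagExponent ≠ 0 := by
  intro h
  have h0 : 0 < a.size := hM _ a.size_mem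
  have := DFunLike.congr_fun h
    (⟨0, h0.trans_le (Finset.le_sup (f := id) a.size_mem)⟩, a.col ⟨0, h0⟩)
  rw [diagExponent_apply, if_pos (a.ext_of_lt h0)] at this
  simp at this

/-- Equal exponents force equal smallest factors, each being below the other; cancel them and
recurse. -/
theorem sum_diagExponent_injective (hM : ∀ p ∈ M, 1 ≤ p) :
    Function.Injective fun l : StandardSeq M n => (l.1.map diagExponent).sum := by
  suffices h : ∀ l l' : List (FlagMinor M n), l.Pairwise (· ≤ ·) → l'.Pairwise (· ≤ ·) →
      (l.map diagExponent).sum = (l'.map diagExponent).sum → l = l' from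
    fun l l' hl => Subtype.ext (h l.1 l'.1 l.2 l'.2 hl)
  have key : ∀ (a : FlagMinor M n) l, ((a :: l).map diagExponent).sum ≠ 0 := by
    intro a l h
    rw [List.map_cons, List.sum_cons] at h
    exact diagExponent_ne_zero hM a (add_eq_zero.mp h).1
  intro l
  induction l with
  | nil =>
    intro l' _ _ h
    cases l' with
    | nil => rfl
    | cons b l' => exact (key b l' h.symm).elim
  | cons a l ih =>
    intro l' hl hl' h
    cases l' with
    | nil => exact (key a l h).elim
    | cons b l' =>
      obtain rfl : a = b := le_antisymm
        (le_of_sum_diagExponent_le b a l' (a :: l) (fun c hc => by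
          rcases List.mem_cons.mp hc with rfl | hc
          exacts [le_rfl, (List.pairwise_cons.mp hl).1 c hc]) h.symm)
        (le_of_sum_diagExponent_le a b l (b :: l') (fun c hc => by
          rcases List.mem_cons.mp hc with rfl | hc
          exacts [le_rfl, (List.pairwise_cons.mp hl').1 c hc]) h)
      rw [ih l' (List.pairwise_cons.mp hl).2 (List.pairwise_cons.mp hl').2 (by simpa using h)]

end FlagMinor

theorem leadingTerm_standardMonomial {K : Type*} [Field K] {M : Finset ℕ} {n : ℕ}
    {m : MonomialOrder (Fin (M.sup id) × Fin n)} (hm : m.IsDiagonal K) (l : StandardSeq M n) :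
    m.leadingTerm (standardMonomial K l) = monomial (l.1.map FlagMinor.diagExponent).sum 1 := by
  rw [standardMonomial, leadingTerm_list_prod, List.map_map]
  generalize l.1 = l
  induction l with
  | nil => simp
  | cons a l ih =>
    rw [List.map_cons, List.prod_cons, ih, Function.comp_apply, FlagMinor.leadingTerm_minor hm,
      monomial_mul, List.map_cons, List.sum_cons, mul_one]

/-! ### The initial algebra -/

section InitialAlgebra

variable {K : Type*} [Field K] {M : Finset ℕ} {n : ℕ} {m : MonomialOrder (Fin (M.sup id) × Fin n)}

theorem linearIndependent_leadingTerm_standardMonomial (hM : ∀ p ∈ M, 1 ≤ p)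
    (hm : m.IsDiagonal K) :
    LinearIndependent K fun l : StandardSeq M n => m.leadingTerm (standardMonomial K l) := by
  simp only [leadingTerm_standardMonomial hm]
  have h := (basisMonomials (Fin (M.sup id) × Fin n) K).linearIndependent.comp _
    (FlagMinor.sum_diagExponent_injective (n := n) hM)
  rw [coe_basisMonomials] at h
  exact h

theorem span_leadingTerm_standardMonomial (hM : ∀ p ∈ M, 1 ≤ p) (hm : m.IsDiagonal K) :
    Submodule.span K (Set.range fun l : StandardSeq M n => m.leadingTerm (standardMonomial K l))
      = Subalgebra.toSubmodule (m.initialAlgebra (flagAlgebra K M n)) := by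
  refine le_antisymm (Submodule.span_le.mpr ?_) (Submodule.span_le.mpr ?_)
  · rintro _ ⟨l, rfl⟩
    refine Submodule.subset_span ⟨standardMonomial K l, ?_, rfl⟩
    refine Subalgebra.list_prod_mem _ fun x hx => ?_
    obtain ⟨a, -, rfl⟩ := List.mem_map.mp hx
    exact Algebra.subset_adjoin ⟨a, rfl⟩
  · rintro _ ⟨f, hf, rfl⟩
    refine leadingTerm_mem_span m _ (fun l => ?_) ?_ (FlagMinor.flagAlgebra_le_span K hf)
    · rw [← m.leadingCoeff_leadingTerm, leadingTerm_standardMonomial hm, m.leadingCoeff_monomial]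
    · intro l l' h
      classical
      simp only [← m.degree_leadingTerm (standardMonomial K _), leadingTerm_standardMonomial hm,
        m.degree_monomial, one_ne_zero, if_false] at h
      exact FlagMinor.sum_diagExponent_injective hM h

theorem initialAlgebra_flagAlgebra_eq_adjoin (hM : ∀ p ∈ M, 1 ≤ p) (hm : m.IsDiagonal K) :
    m.initialAlgebra (flagAlgebra K M n) = Algebra.adjoin K
      (m.leadingTerm '' Set.range (FlagMinor.minor K : FlagMinor M n → _)) := by
  refine le_antisymm ?_ (Algebra.adjoin_le ?_)
  · rw [← Subalgebra.toSubmodule.le_iff_le, ← span_leadingTerm_standardMonomial hM hm,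
      Submodule.span_le]
    rintro _ ⟨l, rfl⟩
    simp only [standardMonomial, leadingTerm_list_prod]
    refine Subalgebra.list_prod_mem _ fun x hx => ?_
    obtain ⟨y, hy, rfl⟩ := List.mem_map.mp hx
    obtain ⟨a, -, rfl⟩ := List.mem_map.mp hy
    exact Algebra.subset_adjoin ⟨_, ⟨a, rfl⟩, rfl⟩
  · rintro _ ⟨_, ⟨a, rfl⟩, rfl⟩
    exact Submodule.subset_span ⟨a.minor K, Algebra.subset_adjoin ⟨a, rfl⟩, rfl⟩

theorem hibiIdeal_le_ker (hm : m.IsDiagonal K) (f : MvPolynomial (FlagMinor M n) K)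
    (hf : f ∈ hibiIdeal K (FlagMinor M n)) :
    aeval (fun a : FlagMinor M n => m.leadingTerm (a.minor K)) f = 0 := by
  suffices h : hibiIdeal K (FlagMinor M n) ≤
      RingHom.ker (aeval (R := K) fun a : FlagMinor M n => m.leadingTerm (a.minor K)) from h hf
  refine Ideal.span_le.mpr ?_
  rintro _ ⟨a, b, -, -, rfl⟩
  rw [SetLike.mem_coe, RingHom.mem_ker, map_sub, map_mul, map_mul]
  simp only [aeval_X, FlagMinor.leadingTerm_minor hm, monomial_mul,
    FlagMinor.diagExponent_inf_add_sup, sub_self]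

/-- The homomorphism from the Hibi ring that sends the class of `t_δ` to the initial term
of `δ`. -/
noncomputable def hibiRingMap (hm : m.IsDiagonal K) :
    HibiRing K (FlagMinor M n) →ₐ[K] MvPolynomial (Fin (M.sup id) × Fin n) K :=
  Ideal.Quotient.liftₐ _ (aeval fun a : FlagMinor M n => m.leadingTerm (a.minor K))
    (hibiIdeal_le_ker hm)

theorem hibiRingMap_mk_X (hm : m.IsDiagonal K) (a : FlagMinor M n) :
    hibiRingMap hm (Ideal.Quotient.mk _ (X a)) = m.leadingTerm (a.minor K) :=
  aeval_X _ _

theorem hibiRingMap_range (hm : m.IsDiagonal K) :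
    (hibiRingMap hm).range = Algebra.adjoin K
      (m.leadingTerm '' Set.range (FlagMinor.minor K : FlagMinor M n → _)) := by
  rw [← Set.range_comp, Algebra.adjoin_range_eq_range_aeval]
  ext x
  constructor
  · rintro ⟨y, rfl⟩
    obtain ⟨y, rfl⟩ := Ideal.Quotient.mk_surjective y
    exact ⟨y, rfl⟩
  · rintro ⟨y, rfl⟩
    exact ⟨Ideal.Quotient.mk _ y, rfl⟩

/-- A linear map sending a spanning family to an independent one is injective. -/
theorem hibiRingMap_injective (hM : ∀ p ∈ M, 1 ≤ p) (hm : m.IsDiagonal K) :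
    Function.Injective (hibiRingMap (M := M) (n := n) hm) := by
  have hli := linearIndependent_leadingTerm_standardMonomial (n := n) hM hm
  have hφ : ∀ l : StandardSeq M n, (hibiRingMap hm).toLinearMap ((l.1.map fun a =>
      Ideal.Quotient.mk (hibiIdeal K (FlagMinor M n)) (X a)).prod) =
        m.leadingTerm (standardMonomial K l) := by
    intro l
    rw [AlgHom.toLinearMap_apply, map_list_prod, standardMonomial, leadingTerm_list_prod,
      List.map_map, List.map_map]
    exact congrArg List.prod (List.map_congr_left fun a _ => hibiRingMap_mk_X hm a)
  rw [injective_iff_map_eq_zero]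
  intro x hx
  have hx' := Submodule.eq_top_iff'.mp (FlagMinor.hibiRing_span_eq_top (M := M) (n := n) K) x
  obtain ⟨c, rfl⟩ := Finsupp.mem_span_range_iff_exists_finsupp.mp hx'
  have hx0 : (hibiRingMap hm).toLinearMap _ = 0 := hx
  rw [map_finsuppSum] at hx0
  simp only [map_smul, hφ] at hx0
  have hc : c = 0 := (linearIndependent_iff.mp hli) c hx0
  simp [hc]

end InitialAlgebra

theorem mainTheorem12 (K : Type*) [Field K] (n : ℕ) (M : Finset ℕ)
    (hM : ∀ p ∈ M, 1 ≤ p ∧ p < n)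
    (m : MonomialOrder (Fin (M.sup id) × Fin n)) (hm : m.IsDiagonal K) :
    -- the minors in `L(M, n)` form a Sagbi basis of `Flag(M, n)`
    m.IsSagbiBasis (flagAlgebra K M n) (Set.range (FlagMinor.minor K : FlagMinor M n → _)) ∧
    -- the initial terms of the standard monomials are a `K`-basis of the initial algebra
    (LinearIndependent K (fun l : StandardSeq M n => m.leadingTerm (standardMonomial K l)) ∧
      Submodule.span K
          (Set.range fun l : StandardSeq M n => m.leadingTerm (standardMonomial K l))
        = Subalgebra.toSubmodule (m.initialAlgebra (flagAlgebra K M n))) ∧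
    -- the initial algebra is the Hibi ring, with `δ ∈ L(M, n)` corresponding to its initial term
    (∃ e : HibiRing K (FlagMinor M n) ≃ₐ[K] m.initialAlgebra (flagAlgebra K M n),
      ∀ δ : FlagMinor M n,
        (e (Ideal.Quotient.mk (hibiIdeal K (FlagMinor M n)) (MvPolynomial.X δ)) :
            MvPolynomial (Fin (M.sup id) × Fin n) K)
          = m.leadingTerm (δ.minor K)) := by
  have hM1 : ∀ p ∈ M, 1 ≤ p := fun p hp => (hM p hp).1
  have hspan := span_leadingTerm_standardMonomial hM1 hm
  refine ⟨⟨Algebra.subset_adjoin, initialAlgebra_flagAlgebra_eq_adjoin hM1 hm⟩,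
    ⟨linearIndependent_leadingTerm_standardMonomial hM1 hm, hspan⟩, ?_⟩
  refine ⟨(AlgEquiv.ofInjective _ (hibiRingMap_injective hM1 hm)).trans
    (Subalgebra.equivOfEq _ _ ?_), fun δ => hibiRingMap_mk_X hm δ⟩
  -- The image and the initial algebra are both generated by the initial terms of the minors.
  rw [hibiRingMap_range, initialAlgebra_flagAlgebra_eq_adjoin hM1 hm]
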